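/- For a partially ordered set $X$ and $A\subseteq X$ let ${\uparrow}A$ and ${\downarrow}A$ be the upset and the downset generated by $A$. An \emph{Esakia space} is a compact space $X$ with a partial order such that (i) whenever $x\not\le y$ there is a clopen upset $U$ with $x\in U$, $y\notin U$, and (ii) ${\downarrow}U$ is clopen for each clopen $U\subseteq X$. Let $\mathfrak{CU}(X)$ denote the set of clopen upsets of $X$ and $\max X$ the set of maximal points of $X$. Let $X,Y$ be Esakia spaces. A partial function $f:X\to Y$ is a \emph{partial Esakia function} if (1) for $x,y\in\mathrm{dom}(f)$, $x<y$ implies $f(x)<f(y)$; (2) for $x\in\mathrm{dom}(f)$ and $y\in Y$, if $f(x)<y$, then there is $z\in\mathrm{dom}(f)$ with $x<z$ and $f(z)=y$; (3) if $U\in\mathfrak{CU}(Y)$, then $({\downarrow}f^{-1}(U^c))^c\in\mathfrak{CU}(X)$; (4) for $x\in X$ and $y\in Y$, if $y\notin f[{\uparrow}x]$, then there is $U\in\mathfrak{CU}(Y)$ with $f[{\uparrow}x]\subseteq U$ and $y\notin U$. It is \emph{well} if $\max X\subseteq\mathrm{dom}(f)$, and it is a \emph{partial Heyting function} if for each $x\in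 X$ there is $z\in\mathrm{dom}(f)$ with $x\le z$ and $f[{\uparrow}x]={\uparrow}f(z)$. For a partial Esakia function $f:X\to Y$ define $R_f\subseteq X\times Y$ by: $x\,R_f\,y$ iff there is $z\in\mathrm{dom}(f)$ with $x\le z$ and $f(z)=y$. For relations $R\subseteq X\times Y$, $S\subseteq Y\times Z$ let $\Box_R A=\{x: R[x]\subseteq A\}$, and let $x\,(S*R)\,z$ iff $z\in U$ for every $U\in\mathfrak{CU}(Z)$ with $x\in\Box_R\Box_S U$. For a relation $R\subseteq X\times Y$ let $f_R$ be the partial function whose domain consists of those $x\in X$ for which $R[x]$ has a least element and which are maximal in $\{x'\in X: R[x']=R[x]\}$, with $f_R(x)$ the least element of $R[x]$. Partial Esakia functions $f:X\to Y$ and $g:Y\to Z$ are composed by $g*f=f_{(R_g*R_f)}$. With this composition, and with identity functions as identity morphisms, Esakia spaces with partial Esakia functions, with well partial Esakia functions, and with partial Heyting functions form categories $\mathsf{ES}^{\mathsf P}$, $\mathsf{ES}^{\mathsf W}$, and $\mathsf{ES}^{\mathsf H}$, respectively. Let $\mathsf{HA}^{\wedge,\to}$, $\mathsf{HA}^{\wedge,\to,\bot}$,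 and $\mathsf{HA}$ be the categories whose objects are the Heyting algebras and whose morphisms are, respectively, the maps preserving $\wedge,\to$ (and hence $\top$), the maps preserving $\wedge,\to,\bot$, and the Heyting algebra homomorphisms. Then: 1. The category $\mathsf{HA}^{\wedge,\to}$ is dually equivalent to the category $\mathsf{ES}^{\mathsf P}$. 2. The category $\mathsf{HA}^{\wedge,\to,\bot}$ is dually equivalent to the category $\mathsf{ES}^{\mathsf W}$. 3. The category $\mathsf{HA}$ is dually equivalent to the category $\mathsf{ES}^{\mathsf H}$. -/

import Mathlib

open CategoryTheory

universe u

namespace PartialEsakia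

/-! ### Heyting algebras with implicative meet semi-lattice homomorphisms -/

/-- A `(∧, →)`-homomorphism of Heyting algebras: a map preserving `⊓` and `⇨`
(it then preserves `⊤ = a ⇨ a`). -/
@[ext]
structure ImpHom (L K : Type u) [HeytingAlgebra L] [HeytingAlgebra K] where
  toFun : L → K
  map_inf : ∀ a b, toFun (a ⊓ b) = toFun a ⊓ toFun b
  map_himp : ∀ a b, toFun (a ⇨ b) = toFun a ⇨ toFun b

/-- Objects of the category of Heyting algebras and `(∧, →)`-homomorphisms. -/
structure HeytAlgImp : Type (u + 1) where
  carrier : Type u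
  [str : HeytingAlgebra carrier]

attribute [instance] HeytAlgImp.str

/-- The category of Heyting algebras and `(∧, →)`-homomorphisms. -/
instance : Category.{u} HeytAlgImp.{u} where
  Hom L K := ImpHom L.carrier K.carrier
  id _ := ⟨id, fun _ _ => rfl, fun _ _ => rfl⟩
  comp h k := ⟨k.toFun ∘ h.toFun,
    fun a b => by simp [h.map_inf, k.map_inf],
    fun a b => by simp [h.map_himp, k.map_himp]⟩

/-- The morphisms that also preserve `⊥`. -/
def preservesBot : MorphismProperty HeytAlgImp.{u} := fun L K (h : ImpHom L.carrier K.carrier) =>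
  h.toFun ⊥ = ⊥

instance : preservesBot.{u}.IsMultiplicative where
  id_mem _ := rfl
  comp_mem h k hh hk := by
    change k.toFun (h.toFun ⊥) = ⊥
    have hh' : h.toFun ⊥ = ⊥ := hh
    rw [hh']
    exact hk

/-- The category of Heyting algebras and `(∧, →, ⊥)`-homomorphisms. -/
abbrev HeytAlgImpBot : Type (u + 1) := WideSubcategory preservesBot.{u}

/-! ### Esakia spaces -/

/-- An Esakia space is a compact ordered space satisfying the Priestley separation axiom
in which the downset of each clopen set is clopen. -/
class EsakiaSpace (X : Type*) [TopologicalSpace X] [PartialOrder X] : Prop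
    extends CompactSpace X, PriestleySpace X where
  isClopen_lowerClosure : ∀ U : Set X, IsClopen U → IsClopen (lowerClosure U : Set X)

/-- `IsCU U` says that `U` is a clopen upset. -/
def IsCU {X : Type*} [TopologicalSpace X] [Preorder X] (U : Set X) : Prop :=
  IsClopen U ∧ IsUpperSet U

section

set_option linter.unusedSectionVars false

variable {X Y Z : Type*}
  [TopologicalSpace X] [PartialOrder X] [TopologicalSpace Y] [PartialOrder Y]
  [TopologicalSpace Z] [PartialOrder Z]

/-! ### Partial Esakia functions -/

/-- Partial Esakia functions. Here `X →. Y` is the type of partial functions from `X` to `Y`,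
`y ∈ f x` means that `x` is in the domain of `f` and `f x = y`, and `f.image`, `f.preimage`
are the image and the preimage of sets under `f`. -/
structure IsPartialEsakia (f : X →. Y) : Prop where
  lt_of_lt : ∀ ⦃x x' y y'⦄, y ∈ f x → y' ∈ f x' → x < x' → y < y'
  exists_of_lt : ∀ ⦃x y y'⦄, y ∈ f x → y < y' → ∃ z, x < z ∧ y' ∈ f z
  isCU : ∀ ⦃U : Set Y⦄, IsCU U → IsCU (lowerClosure (f.preimage Uᶜ) : Set X)ᶜ
  separated : ∀ ⦃x y⦄, y ∉ f.image (Set.Ici x) →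
    ∃ U : Set Y, IsCU U ∧ f.image (Set.Ici x) ⊆ U ∧ y ∉ U

/-- `f` is well if all maximal points of `X` are in its domain. -/
def IsWell (f : X →. Y) : Prop := {x : X | IsMax x} ⊆ f.Dom

/-- The additional condition on a partial Esakia function that makes it
a partial Heyting function. -/
def IsHeyting (f : X →. Y) : Prop :=
  ∀ x : X, ∃ z, ∃ hz : z ∈ f.Dom, x ≤ z ∧ f.image (Set.Ici x) = Set.Ici (f.fn z hz)

/-! ### The composition of partial Esakia functions -/

/-- The relation `R_f` of a partial function `f`. -/
def relOf (f : X →. Y) (x : X) (y : Y) : Prop := ∃ z, x ≤ z ∧ y ∈ f z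

/-- `□_R A = {x | R[x] ⊆ A}`. -/
def box (R : X → Y → Prop) (A : Set Y) : Set X := {x | ∀ y, R x y → y ∈ A}

/-- The composition `S * R` of generalized Priestley morphisms. -/
def starComp (S : Y → Z → Prop) (R : X → Y → Prop) (x : X) (z : Z) : Prop :=
  ∀ U : Set Z, IsCU U → x ∈ box R (box S U) → z ∈ U

open Classical in
/-- The partial function `f_R` of a relation `R`: its domain consists of those `x` for which
`R[x]` has a least element and which are maximal among the points `x'` with `R[x'] = R[x]`;
its value at such an `x` is the least element of `R[x]`. -/
noncomputable def funOf (R : X → Y → Prop) : X →. Y := fun x =>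
  ⟨(∃ y, IsLeast {y | R x y} y) ∧ Maximal (fun x' => {y | R x' y} = {y | R x y}) x,
    fun h => h.1.choose⟩

/-- The composition `g * f = f_(R_g * R_f)` of partial Esakia functions. -/
noncomputable def pcomp (g : Y →. Z) (f : X →. Y) : X →. Z :=
  funOf (starComp (relOf g) (relOf f))

theorem mem_funOf {R : X → Y → Prop} {x : X} {y : Y} :
    y ∈ funOf R x ↔ IsLeast {y | R x y} y ∧
      Maximal (fun x' => {y | R x' y} = {y | R x y}) x := by
  constructor
  · rintro ⟨h, rfl⟩
    exact ⟨h.1.choose_spec, h.2⟩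
  · rintro ⟨h, h'⟩
    exact ⟨⟨⟨y, h⟩, h'⟩, (Exists.choose_spec (⟨y, h⟩ : ∃ y, IsLeast {y | R x y} y)).unique h⟩

theorem image_Ici_eq (f : X →. Y) (x : X) : f.image (Set.Ici x) = {y | relOf f x y} := by
  ext y
  simp [PFun.mem_image, relOf]

theorem box_relOf (f : X →. Y) (U : Set Y) :
    box (relOf f) U = (lowerClosure (f.preimage Uᶜ) : Set X)ᶜ := by
  ext x
  simp only [box, relOf, Set.mem_ofPred_eq, Set.mem_compl_iff, SetLike.mem_coe, mem_lowerClosure,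
    PFun.mem_preimage]
  constructor
  · rintro h ⟨z, ⟨y, hy, hz⟩, hxz⟩
    exact hy (h y ⟨z, hxz, hz⟩)
  · rintro h y ⟨z, hxz, hz⟩
    by_contra hy
    exact h ⟨z, ⟨y, hy, hz⟩, hxz⟩

theorem IsPartialEsakia.exists_of_le {f : X →. Y} (hf : IsPartialEsakia f) {x : X} {y y' : Y}
    (hx : y ∈ f x) (hy : y ≤ y') : ∃ z, x ≤ z ∧ y' ∈ f z := by
  rcases hy.eq_or_lt with rfl | h
  · exact ⟨x, le_rfl, hx⟩
  · obtain ⟨z, hz, hz'⟩ := hf.exists_of_lt hx h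
    exact ⟨z, hz.le, hz'⟩

theorem IsPartialEsakia.setOf_relOf {f : X →. Y} (hf : IsPartialEsakia f) {x : X} {y : Y}
    (hx : y ∈ f x) : {y' | relOf f x y'} = Set.Ici y := by
  ext y'
  constructor
  · rintro ⟨z, hxz, hz⟩
    rcases hxz.eq_or_lt with rfl | h
    · exact (Part.mem_unique hx hz).le
    · exact (hf.lt_of_lt hx hz h).le
  · exact fun h => hf.exists_of_le hx h

/-- `f_(R_f) = f`. -/
theorem IsPartialEsakia.funOf_relOf {f : X →. Y} (hf : IsPartialEsakia f) :
    funOf (relOf f) = f := by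
  apply PFun.ext
  intro x y
  rw [mem_funOf]
  constructor
  · rintro ⟨h, hmax⟩
    obtain ⟨z, hxz, hz⟩ := h.1
    have hx : {y' | relOf f x y'} = Set.Ici y := by
      apply Set.Subset.antisymm (fun y' hy' => h.2 hy')
      intro y' hy'
      obtain ⟨w, hw, hw'⟩ := hf.exists_of_le hz hy'
      exact ⟨w, hxz.trans hw, hw'⟩
    have hzx : z ≤ x := hmax.2 ((hf.setOf_relOf hz).trans hx.symm) hxz
    rwa [le_antisymm hxz hzx]
  · intro h
    have hx := hf.setOf_relOf h
    refine ⟨hx ▸ isLeast_Ici, rfl, ?_⟩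
    intro x' hx' hle
    have : relOf f x' y := by
      have : y ∈ {y' | relOf f x' y'} := by rw [hx', hx]; exact Set.self_mem_Ici
      exact this
    obtain ⟨w, hw, hw'⟩ := this
    rcases hle.eq_or_lt with rfl | hlt
    · exact le_rfl
    · exact absurd (hf.lt_of_lt h hw' (hlt.trans_le hw)) (lt_irrefl _)

theorem mem_comp {g : Y →. Z} {f : X →. Y} {x : X} {z : Z} :
    z ∈ g.comp f x ↔ ∃ y, y ∈ f x ∧ z ∈ g y := by
  rw [PFun.comp_apply]
  exact Part.mem_bind_iff

theorem IsPartialEsakia.relOf_comp {g : Y →. Z} {f : X →. Y} (hf : IsPartialEsakia f)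
    (x : X) (z : Z) : relOf (g.comp f) x z ↔ ∃ y, relOf f x y ∧ relOf g y z := by
  constructor
  · rintro ⟨w, hw, hz⟩
    obtain ⟨y, hy, hz⟩ := mem_comp.1 hz
    exact ⟨y, ⟨w, hw, hy⟩, y, le_rfl, hz⟩
  · rintro ⟨y, ⟨w, hw, hy⟩, y', hyy', hz⟩
    obtain ⟨v, hv, hv'⟩ := hf.exists_of_le hy hyy'
    exact ⟨v, hw.trans hv, mem_comp.2 ⟨y', hv', hz⟩⟩

theorem IsPartialEsakia.box_comp {g : Y →. Z} {f : X →. Y} (hf : IsPartialEsakia f)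
    (U : Set Z) : box (relOf (g.comp f)) U = box (relOf f) (box (relOf g) U) := by
  ext x
  simp only [box, Set.mem_ofPred_eq, hf.relOf_comp]
  exact ⟨fun h y hy z hz => h z ⟨y, hy, hz⟩, fun h z ⟨y, hy, hz⟩ => h y hy z hz⟩

theorem IsPartialEsakia.isCU_box {f : X →. Y} (hf : IsPartialEsakia f) {U : Set Y}
    (hU : IsCU U) : IsCU (box (relOf f) U) := by
  rw [box_relOf]; exact hf.isCU hU

theorem IsPartialEsakia.exists_separating [CompactSpace Y] {g : Y →. Z} {f : X →. Y}
    (hg : IsPartialEsakia g) (hf : IsPartialEsakia f) {x : X} {z : Z}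
    (h : ¬ ∃ y, relOf f x y ∧ relOf g y z) :
    ∃ U : Set Z, IsCU U ∧ x ∈ box (relOf f) (box (relOf g) U) ∧ z ∉ U := by
  push Not at h
  have hclosed : IsClosed {y | relOf f x y} := by
    rw [← isOpen_compl_iff, isOpen_iff_forall_mem_open]
    intro y hy
    rw [← image_Ici_eq] at hy
    obtain ⟨U, hU, hxU, hyU⟩ := hf.separated hy
    refine ⟨Uᶜ, ?_, hU.1.1.isOpen_compl, hyU⟩
    rw [← image_Ici_eq]
    exact Set.compl_subset_compl.2 hxU
  have hsep : ∀ y : {y | relOf f x y}, ∃ U : Set Z, IsCU U ∧ (y : Y) ∈ box (relOf g) U ∧ z ∉ U := by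
    intro y
    have hz : z ∉ g.image (Set.Ici (y : Y)) := by
      rw [image_Ici_eq]; exact h y y.2
    obtain ⟨U, hU, hyU, hzU⟩ := hg.separated hz
    rw [image_Ici_eq] at hyU
    exact ⟨U, hU, fun z' hz' => hyU hz', hzU⟩
  choose U hU hyU hzU using hsep
  obtain ⟨t, ht⟩ := hclosed.isCompact.elim_finite_subcover
    (fun y => box (relOf g) (U y)) (fun y => (hg.isCU_box (hU y)).1.2)
    (fun y hy => Set.mem_iUnion.2 ⟨⟨y, hy⟩, hyU ⟨y, hy⟩⟩)
  refine ⟨⋃ y ∈ t, U y, ⟨?_, ?_⟩, ?_, ?_⟩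
  · exact t.finite_toSet.isClopen_biUnion fun y _ => (hU y).1
  · exact isUpperSet_iUnion₂ fun y _ => (hU y).2
  · intro y hy z' hz'
    obtain ⟨i, hi, hi'⟩ := Set.mem_iUnion₂.1 (ht hy)
    exact Set.mem_iUnion₂.2 ⟨i, hi, hi' z' hz'⟩
  · intro hz
    obtain ⟨i, _, hi⟩ := Set.mem_iUnion₂.1 hz
    exact hzU i hi

theorem IsPartialEsakia.comp [CompactSpace Y] {g : Y →. Z} {f : X →. Y}
    (hg : IsPartialEsakia g) (hf : IsPartialEsakia f) : IsPartialEsakia (g.comp f) where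
  lt_of_lt x x' z z' hz hz' hlt := by
    obtain ⟨y, hy, hz⟩ := mem_comp.1 hz
    obtain ⟨y', hy', hz'⟩ := mem_comp.1 hz'
    exact hg.lt_of_lt hz hz' (hf.lt_of_lt hy hy' hlt)
  exists_of_lt x z z' hz hlt := by
    obtain ⟨y, hy, hz⟩ := mem_comp.1 hz
    obtain ⟨y', hyy', hy'⟩ := hg.exists_of_lt hz hlt
    obtain ⟨x', hxx', hx'⟩ := hf.exists_of_lt hy hyy'
    exact ⟨x', hxx', mem_comp.2 ⟨y', hx', hy'⟩⟩
  isCU U hU := by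
    rw [← box_relOf, hf.box_comp]
    exact hf.isCU_box (hg.isCU_box hU)
  separated x z hz := by
    rw [image_Ici_eq] at hz ⊢
    obtain ⟨U, hU, hxU, hzU⟩ := hg.exists_separating hf (x := x) (z := z)
      (fun h => hz ((hf.relOf_comp x z).2 h))
    rw [← hf.box_comp] at hxU
    exact ⟨U, hU, fun z' hz' => hxU z' hz', hzU⟩

/-- For partial Esakia functions, `g * f` is the usual composition of partial functions. -/
theorem IsPartialEsakia.pcomp_eq [CompactSpace Y] {g : Y →. Z} {f : X →. Y}
    (hg : IsPartialEsakia g) (hf : IsPartialEsakia f) : pcomp g f = g.comp f := by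
  have : starComp (relOf g) (relOf f) = relOf (g.comp f) := by
    funext x z
    rw [eq_iff_iff, hf.relOf_comp]
    constructor
    · intro h
      by_contra hn
      obtain ⟨U, hU, hxU, hzU⟩ := hg.exists_separating hf hn
      exact hzU (h U hU hxU)
    · rintro ⟨y, hy, hz⟩ U _ hxU
      exact hxU y hy z hz
  rw [pcomp, this, (hg.comp hf).funOf_relOf]

theorem isPartialEsakia_id [PriestleySpace X] : IsPartialEsakia (PFun.id X) where
  lt_of_lt x x' y y' hy hy' hlt := by
    rw [PFun.id_apply, Part.mem_some_iff] at hy hy'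
    rwa [hy, hy']
  exists_of_lt x y y' hy hlt := by
    rw [PFun.id_apply, Part.mem_some_iff] at hy
    exact ⟨y', hy ▸ hlt, by simp⟩
  isCU U hU := by
    have : (lowerClosure ((PFun.id X).preimage Uᶜ) : Set X)ᶜ = U := by
      rw [← box_relOf]
      ext x
      simp only [box, relOf, PFun.id_apply, Part.mem_some_iff, Set.mem_ofPred_eq]
      exact ⟨fun h => h x ⟨x, le_rfl, rfl⟩, fun h y ⟨z, hz, hy⟩ => hU.2 (hy ▸ hz) h⟩
    rwa [this]
  separated x y hy := by
    have himage : (PFun.id X).image (Set.Ici x) = Set.Ici x := by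
      ext; simp [PFun.mem_image]
    rw [himage] at hy ⊢
    obtain ⟨U, hU, hU', hx, hy⟩ := PriestleySpace.priestley (fun h : x ≤ y => hy h)
    exact ⟨U, ⟨hU, hU'⟩, fun z hz => hU' hz hx, hy⟩

/-- The identity function is `f_≤`. -/
theorem funOf_le [PriestleySpace X] : funOf (fun x y : X => x ≤ y) = PFun.id X := by
  rw [← (isPartialEsakia_id (X := X)).funOf_relOf]
  congr 1
  funext x y
  simp [relOf]

theorem isWell_id : IsWell (PFun.id X) := fun _ _ => trivial

theorem isHeyting_id : IsHeyting (PFun.id X) := fun x =>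
  ⟨x, trivial, le_rfl, by
    have : (PFun.id X).fn x trivial = x := rfl
    rw [this]
    ext
    simp [PFun.mem_image]⟩

theorem IsWell.comp {g : Y →. Z} {f : X →. Y} (hg : IsWell g) (hf : IsWell f)
    (hf' : IsPartialEsakia f) : IsWell (g.comp f) := by
  intro x hx
  obtain ⟨y, hy⟩ := (PFun.mem_dom f x).1 (hf hx)
  have hmax : IsMax y := by
    rw [isMax_iff_forall_not_lt]
    intro y' hlt
    obtain ⟨z, hz, _⟩ := hf'.exists_of_lt hy hlt
    exact hx.not_lt hz
  obtain ⟨z, hz⟩ := (PFun.mem_dom g y).1 (hg hmax)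
  exact (PFun.mem_dom _ x).2 ⟨z, mem_comp.2 ⟨y, hy, hz⟩⟩

theorem isHeyting_iff {f : X →. Y} : IsHeyting f ↔
    ∀ x, ∃ z y, x ≤ z ∧ y ∈ f z ∧ {y' | relOf f x y'} = Set.Ici y := by
  refine forall_congr' fun x => exists_congr fun z => ?_
  rw [image_Ici_eq]
  constructor
  · rintro ⟨hz, hxz, h⟩
    exact ⟨f.fn z hz, hxz, Part.get_mem hz, h⟩
  · rintro ⟨y, hxz, ⟨hz, rfl⟩, h⟩
    exact ⟨hz, hxz, h⟩

theorem IsHeyting.comp {g : Y →. Z} {f : X →. Y} (hg : IsHeyting g) (hf : IsHeyting f)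
    (hf' : IsPartialEsakia f) : IsHeyting (g.comp f) := by
  rw [isHeyting_iff] at *
  intro x
  obtain ⟨x₁, y₁, hx, hy₁, h₁⟩ := hf x
  obtain ⟨y₂, z, hy, hz, h₂⟩ := hg y₁
  obtain ⟨x₂, hx₂, hy₂⟩ := hf'.exists_of_le hy₁ hy
  refine ⟨x₂, z, hx.trans hx₂, mem_comp.2 ⟨y₂, hy₂, hz⟩, ?_⟩
  rw [← h₂]
  ext z'
  simp only [Set.mem_ofPred_eq, hf'.relOf_comp]
  constructor
  · rintro ⟨y, hxy, w, hw, hz'⟩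
    have : y₁ ≤ y := by
      have : y ∈ Set.Ici y₁ := by rw [← h₁]; exact hxy
      exact this
    exact ⟨w, this.trans hw, hz'⟩
  · exact fun h => ⟨y₁, ⟨x₁, hx, hy₁⟩, h⟩

end

/-! ### The categories of Esakia spaces and partial functions -/

/-- A bundled partial Esakia function. -/
@[ext]
structure PartialEsakiaHom (X Y : Type u) [TopologicalSpace X] [PartialOrder X]
    [TopologicalSpace Y] [PartialOrder Y] where
  toPFun : X →. Y
  isPartialEsakia : IsPartialEsakia toPFun

/-- Objects of the category of Esakia spaces and partial Esakia functions. -/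
structure EsakiaP : Type (u + 1) where
  carrier : Type u
  [top : TopologicalSpace carrier]
  [order : PartialOrder carrier]
  [esakia : EsakiaSpace carrier]

attribute [instance] EsakiaP.top EsakiaP.order EsakiaP.esakia

/-- The category of Esakia spaces and partial Esakia functions, with the composition `*`. -/
noncomputable instance : Category.{u} EsakiaP.{u} where
  Hom X Y := PartialEsakiaHom X.carrier Y.carrier
  id X := ⟨PFun.id X.carrier, isPartialEsakia_id⟩
  comp f g := ⟨pcomp g.toPFun f.toPFun, by
    rw [g.isPartialEsakia.pcomp_eq f.isPartialEsakia]
    exact g.isPartialEsakia.comp f.isPartialEsakia⟩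
  id_comp f := by
    apply PartialEsakiaHom.ext
    exact (f.isPartialEsakia.pcomp_eq isPartialEsakia_id).trans (PFun.comp_id _)
  comp_id f := by
    apply PartialEsakiaHom.ext
    exact (isPartialEsakia_id.pcomp_eq f.isPartialEsakia).trans (PFun.id_comp _)
  assoc f g h := by
    apply PartialEsakiaHom.ext
    have hf := f.isPartialEsakia
    have hg := g.isPartialEsakia
    have hh := h.isPartialEsakia
    change pcomp h.toPFun (pcomp g.toPFun f.toPFun) = pcomp (pcomp h.toPFun g.toPFun) f.toPFun
    rw [hg.pcomp_eq hf, hh.pcomp_eq hg, hh.pcomp_eq (hg.comp hf), (hh.comp hg).pcomp_eq hf,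
      PFun.comp_assoc]

/-- The well partial Esakia functions. -/
def isWell : MorphismProperty EsakiaP.{u} :=
  fun X Y (f : PartialEsakiaHom X.carrier Y.carrier) => IsWell f.toPFun

/-- The partial Heyting functions. -/
def isHeyting : MorphismProperty EsakiaP.{u} :=
  fun X Y (f : PartialEsakiaHom X.carrier Y.carrier) => IsHeyting f.toPFun

instance : isWell.{u}.IsMultiplicative where
  id_mem _ := isWell_id
  comp_mem f g hf hg := by
    change IsWell (pcomp g.toPFun f.toPFun)
    rw [g.isPartialEsakia.pcomp_eq f.isPartialEsakia]
    exact IsWell.comp hg hf f.isPartialEsakia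

instance : isHeyting.{u}.IsMultiplicative where
  id_mem _ := isHeyting_id
  comp_mem f g hf hg := by
    change IsHeyting (pcomp g.toPFun f.toPFun)
    rw [g.isPartialEsakia.pcomp_eq f.isPartialEsakia]
    exact IsHeyting.comp hg hf f.isPartialEsakia

/-- The category of Esakia spaces and well partial Esakia functions. -/
abbrev EsakiaW : Type (u + 1) := WideSubcategory isWell.{u}

/-- The category of Esakia spaces and partial Heyting functions. -/
abbrev EsakiaH : Type (u + 1) := WideSubcategory isHeyting.{u}

end PartialEsakia

/-! All three equivalences come from one functor, `clopenUpsets`, sending `X` to its Heyting algebra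
of clopen upsets and `f` to `U ↦ □_{R_f} U`.

Faithful: condition (4) makes `R_f[x]` the intersection of the clopen upsets containing it, so the
dual map determines `R_f`, and `funOf_relOf` recovers `f`.

Full: a `(∧, →)`-homomorphism `h` defines the relation `h.rel`. The crux is
`ImpHom.exists_mem_funOf`: if `x` is related to `y`, a maximal `z ≥ x` still related to `y` has `y`
as its least value, by compactness and preservation of `→`. Thus `funOf h.rel` has relation `h.rel`,
and its dual is `h`.

Essentially surjective: prime filters give each Heyting algebra an Esakia space whose clopen upsets
represent it.

For the two subcategories, `isWell_iff` and `isHeyting_iff_dual` translate the extra conditions on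
`f` into preservation of `⊥` and of finite joins. -/

namespace PartialEsakia

/-! ### Maximal points of closed sets -/

section OrderTopology

variable {X : Type*} [TopologicalSpace X] [PartialOrder X] [PriestleySpace X]

theorem isClosed_Ici_of_priestley (x : X) : IsClosed (Set.Ici x) := by
  rw [← isOpen_compl_iff, isOpen_iff_forall_mem_open]
  intro y hy
  obtain ⟨U, hU, hU', hx, hyU⟩ := exists_isClopen_upper_of_not_le (show ¬ x ≤ y from hy)
  exact ⟨Uᶜ, fun z hz hxz => hz (hU' hxz hx), hU.compl.isOpen, hyU⟩

/-- In a compact Priestley space, every point of a closed set lies below a maximal point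
of that set. -/
theorem exists_le_maximal_of_isClosed [CompactSpace X] {S : Set X} (hS : IsClosed S) {x : X}
    (hx : x ∈ S) : ∃ m, x ≤ m ∧ Maximal (· ∈ S) m := by
  refine zorn_le_nonempty₀ S (fun c hcS hc y hy => ?_) x hx
  have : Nonempty c := ⟨⟨y, hy⟩⟩
  obtain ⟨m, hm⟩ := IsCompact.nonempty_iInter_of_directed_nonempty_isCompact_isClosed
    (fun z : c => S ∩ Set.Ici (z : X))
    (fun a b => by
      rcases hc.total a.2 b.2 with h | h
      · exact ⟨b, fun z hz => ⟨hz.1, h.trans hz.2⟩, subset_rfl⟩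
      · exact ⟨a, subset_rfl, fun z hz => ⟨hz.1, h.trans hz.2⟩⟩)
    (fun z => ⟨z, hcS z.2, le_rfl⟩)
    (fun z => (hS.inter (isClosed_Ici_of_priestley _)).isCompact)
    (fun z => hS.inter (isClosed_Ici_of_priestley _))
  rw [Set.mem_iInter] at hm
  exact ⟨m, (hm ⟨y, hy⟩).1, fun z hz => (hm ⟨z, hz⟩).2⟩

end OrderTopology

/-! ### The Heyting algebra of clopen upsets -/

section ClopenUpsets

variable {X : Type*} [TopologicalSpace X] [PartialOrder X]

theorem isCU_coe (U : ClopenUpperSet X) : IsCU (U : Set X) := ⟨U.isClopen, U.upper⟩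

/-- The bundled clopen upset of a set satisfying `IsCU`. -/
def IsCU.toClopenUpperSet {U : Set X} (hU : IsCU U) : ClopenUpperSet X := ⟨⟨U, hU.1⟩, hU.2⟩

theorem ClopenUpperSet.mem_sup {U V : ClopenUpperSet X} {x : X} :
    x ∈ U ⊔ V ↔ x ∈ U ∨ x ∈ V := Iff.rfl

theorem ClopenUpperSet.notMem_bot {x : X} : x ∉ (⊥ : ClopenUpperSet X) := fun h => h

variable [EsakiaSpace X]

/-- This set is the implication `U ⇨ V`; Esakia's condition on downsets is what makes it clopen. -/
theorem isCU_compl_lowerClosure_diff (U V : ClopenUpperSet X) :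
    IsCU (lowerClosure ((U : Set X) \ V) : Set X)ᶜ :=
  ⟨(EsakiaSpace.isClopen_lowerClosure _ (U.isClopen.diff V.isClopen)).compl,
    (lowerClosure _).lower.compl⟩

/-- The Heyting algebra of clopen upsets of an Esakia space. -/
noncomputable instance : HeytingAlgebra (ClopenUpperSet X) :=
  letI : DistribLattice (ClopenUpperSet X) :=
    { (inferInstance : Lattice (ClopenUpperSet X)) with
      le_sup_inf := fun U V W x h => by
        rcases h with ⟨h | h, h' | h'⟩
        · exact Or.inl h
        · exact Or.inl h
        · exact Or.inl h'
        · exact Or.inr ⟨h, h'⟩ }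
  HeytingAlgebra.ofHImp
    (fun U V => (isCU_compl_lowerClosure_diff U V).toClopenUpperSet)
    (fun U V W => by
      constructor
      · rintro h x ⟨hx, hxV⟩
        by_contra hxW
        exact h hx (subset_lowerClosure ⟨hxV, hxW⟩)
      · rintro h x hx ⟨y, ⟨hyV, hyW⟩, hxy⟩
        exact hyW (h ⟨U.upper hxy hx, hyV⟩))

theorem ClopenUpperSet.mem_himp {U V : ClopenUpperSet X} {x : X} :
    x ∈ U ⇨ V ↔ ∀ y, x ≤ y → y ∈ U → y ∈ V := by
  change x ∉ lowerClosure ((U : Set X) \ V) ↔ _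
  rw [mem_lowerClosure]
  constructor
  · intro h y hxy hyU
    by_contra hyV
    exact h ⟨y, ⟨hyU, hyV⟩, hxy⟩
  · rintro h ⟨y, ⟨hyU, hyV⟩, hxy⟩
    exact hyV (h y hxy hyU)

theorem ClopenUpperSet.exists_mem_notMem {x y : X} (h : ¬ x ≤ y) :
    ∃ U : ClopenUpperSet X, x ∈ U ∧ y ∉ U := by
  obtain ⟨U, hU, hU', hx, hy⟩ := exists_isClopen_upper_of_not_le h
  exact ⟨⟨⟨U, hU⟩, hU'⟩, hx, hy⟩

end ClopenUpsets

/-! ### Partial Esakia functions and their dual homomorphisms -/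

section Dual

variable {X Y : Type u} [TopologicalSpace X] [PartialOrder X] [EsakiaSpace X]
  [TopologicalSpace Y] [PartialOrder Y] [EsakiaSpace Y]

/-- The `(∧, →)`-homomorphism `U ↦ □_{R_f} U` dual to a partial Esakia function `f`. -/
noncomputable def IsPartialEsakia.dual {f : X →. Y} (hf : IsPartialEsakia f) :
    ImpHom (ClopenUpperSet Y) (ClopenUpperSet X) where
  toFun U := (hf.isCU_box (isCU_coe U)).toClopenUpperSet
  map_inf U V := by
    ext x
    exact ⟨fun h => ⟨fun y hy => (h y hy).1, fun y hy => (h y hy).2⟩,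
      fun h y hy => ⟨h.1 y hy, h.2 y hy⟩⟩
  map_himp U V := SetLike.ext fun x => by
    rw [ClopenUpperSet.mem_himp]
    constructor
    · rintro h x' hx hU y ⟨z, hz, hy⟩
      exact ClopenUpperSet.mem_himp.1 (h y ⟨z, hx.trans hz, hy⟩) y le_rfl (hU y ⟨z, hz, hy⟩)
    · rintro h y ⟨z, hz, hy⟩
      refine ClopenUpperSet.mem_himp.2 fun y' hyy' hU => ?_
      -- Condition (2) realizes `y'` as the value at a point `w` above `x`; then `R_f[w] = ↑y' ⊆ U`,
      -- so the hypothesis applies at `w`.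
      obtain ⟨w, hw, hy'⟩ := hf.exists_of_le hy hyy'
      refine h w (hz.trans hw) (fun y'' hy'' => ?_) y' ⟨w, le_rfl, hy'⟩
      have : y'' ∈ Set.Ici y' := by rw [← hf.setOf_relOf hy']; exact hy''
      exact U.upper this hU

theorem IsPartialEsakia.mem_dual {f : X →. Y} (hf : IsPartialEsakia f) {U : ClopenUpperSet Y}
    {x : X} : x ∈ hf.dual.toFun U ↔ ∀ y, relOf f x y → y ∈ U := Iff.rfl

theorem IsPartialEsakia.relOf_iff {f : X →. Y} (hf : IsPartialEsakia f) {x : X} {y : Y} :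
    relOf f x y ↔ ∀ U, x ∈ hf.dual.toFun U → y ∈ U := by
  refine ⟨fun h U hU => hU y h, fun h => ?_⟩
  by_contra hn
  obtain ⟨U, hU, hxU, hyU⟩ := hf.separated (x := x) (y := y) (by rwa [image_Ici_eq])
  rw [image_Ici_eq] at hxU
  exact hyU (h hU.toClopenUpperSet fun y hy => hxU hy)

theorem IsPartialEsakia.eq_of_dual_eq {f g : X →. Y} (hf : IsPartialEsakia f)
    (hg : IsPartialEsakia g) (h : hf.dual = hg.dual) : f = g := by
  have : relOf f = relOf g := by
    funext x y
    rw [eq_iff_iff, hf.relOf_iff, hg.relOf_iff, h]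
  rw [← hf.funOf_relOf, this, hg.funOf_relOf]

/-- A point is in the dual of `⊥` exactly when no point of the domain lies above it. Every point
lies below a maximal one, and a maximal point has only itself above it. -/
theorem IsPartialEsakia.isWell_iff {f : X →. Y} (hf : IsPartialEsakia f) :
    IsWell f ↔ hf.dual.toFun ⊥ = ⊥ := by
  constructor
  · intro h
    refine SetLike.ext fun x => ⟨fun hx => ?_, fun hx => (ClopenUpperSet.notMem_bot hx).elim⟩
    obtain ⟨m, hxm, -, hm⟩ := exists_le_maximal_of_isClosed isClosed_univ (Set.mem_univ x)
    obtain ⟨y, hy⟩ := (PFun.mem_dom f m).1 (h (show IsMax m from fun z hz => hm trivial hz))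
    exact hx y ⟨m, hxm, hy⟩
  · intro h x hx
    have : x ∉ hf.dual.toFun ⊥ := by rw [h]; exact ClopenUpperSet.notMem_bot
    rw [hf.mem_dual] at this
    push Not at this
    obtain ⟨y, ⟨z, hxz, hz⟩, -⟩ := this
    rw [← hx.eq_of_le hxz] at hz
    exact (PFun.mem_dom f x).2 ⟨y, hz⟩

/-- A least element `y` of `R_f[x]` turns `x ∈ □U` into `y ∈ U`, which commutes with finite joins.
Conversely, without a least element each point of `R_f[x]` lies in a clopen upset not containing all
of `R_f[x]`; compactness and preservation of joins merge these into one such upset covering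
`R_f[x]`, a contradiction. -/
theorem IsPartialEsakia.isHeyting_iff_dual {f : X →. Y} (hf : IsPartialEsakia f) :
    IsHeyting f ↔ hf.dual.toFun ⊥ = ⊥ ∧
      ∀ U V, hf.dual.toFun (U ⊔ V) = hf.dual.toFun U ⊔ hf.dual.toFun V := by
  rw [isHeyting_iff]
  constructor
  · intro h
    have key : ∀ x, ∃ y, ∀ U, x ∈ hf.dual.toFun U ↔ y ∈ U := fun x => by
      obtain ⟨z, y, -, -, hR⟩ := h x
      refine ⟨y, fun U => ⟨fun hU => hU y ?_, fun hU y' hy' => ?_⟩⟩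
      · change y ∈ {y' | relOf f x y'}
        rw [hR]; exact Set.self_mem_Ici
      · have : y' ∈ Set.Ici y := by rw [← hR]; exact hy'
        exact U.upper this hU
    refine ⟨SetLike.ext fun x => ?_, fun U V => SetLike.ext fun x => ?_⟩ <;>
      obtain ⟨y, hy⟩ := key x
    · exact ⟨fun hx => ((hy _).1 hx).elim, fun hx => (ClopenUpperSet.notMem_bot hx).elim⟩
    · rw [ClopenUpperSet.mem_sup, hy, hy, hy, ClopenUpperSet.mem_sup]
  · rintro ⟨hbot, hsup⟩ x
    have hleast : ∃ y, relOf f x y ∧ ∀ y', relOf f x y' → y ≤ y' := by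
      by_contra! hn
      have hclosed : IsClosed {y | relOf f x y} := by
        have : {y | relOf f x y} =
            ⋂ U : {U // x ∈ hf.dual.toFun U}, ((U : ClopenUpperSet Y) : Set Y) := by
          ext y
          rw [Set.mem_iInter, Subtype.forall]
          exact hf.relOf_iff
        rw [this]
        exact isClosed_iInter fun U => U.1.isClopen.isClosed
      -- Preservation of `⊥` is what excludes an empty `R_f[x]`.
      have : Nonempty {U // x ∉ hf.dual.toFun U} :=
        ⟨⊥, by rw [hbot]; exact ClopenUpperSet.notMem_bot⟩
      obtain ⟨U, hU⟩ := hclosed.isCompact.elim_directed_cover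
        (fun U : {U // x ∉ hf.dual.toFun U} => ((U : ClopenUpperSet Y) : Set Y))
        (fun U => U.1.isClopen.isOpen)
        (fun y hy => by
          obtain ⟨y', hy', hle⟩ := hn y hy
          obtain ⟨U, hyU, hyU'⟩ := ClopenUpperSet.exists_mem_notMem hle
          exact Set.mem_iUnion.2 ⟨⟨U, fun h => hyU' (h y' hy')⟩, hyU⟩)
        (fun U V => ⟨⟨U.1 ⊔ V.1, by
          rw [hsup, ClopenUpperSet.mem_sup, not_or]; exact ⟨U.2, V.2⟩⟩,
          Set.subset_union_left, Set.subset_union_right⟩)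
      exact U.2 fun y hy => hU hy
    obtain ⟨y, ⟨z, hxz, hz⟩, hy⟩ := hleast
    refine ⟨z, y, hxz, hz, Set.Subset.antisymm hy fun y' hy' => ?_⟩
    obtain ⟨w, hw, hw'⟩ := hf.exists_of_le hz hy'
    exact ⟨w, hxz.trans hw, hw'⟩

/-! ### From homomorphisms back to partial Esakia functions -/

theorem ImpHom.monotone {L K : Type u} [HeytingAlgebra L] [HeytingAlgebra K] (h : ImpHom L K) :
    Monotone h.toFun := fun a b hab => by
  rw [← inf_eq_left, ← h.map_inf, inf_eq_left.2 hab]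

/-- The relation between the points of Esakia spaces given by a map of their clopen upsets. -/
def ImpHom.rel (h : ImpHom (ClopenUpperSet Y) (ClopenUpperSet X)) (x : X) (y : Y) : Prop :=
  ∀ U, x ∈ h.toFun U → y ∈ U

variable (h : ImpHom (ClopenUpperSet Y) (ClopenUpperSet X))

theorem ImpHom.rel_of_le {x x' : X} {y y' : Y} (hx : x ≤ x') (hxy : h.rel x' y) (hy : y ≤ y') :
    h.rel x y' :=
  fun U hU => U.upper hy (hxy U ((h.toFun U).upper hx hU))

/-- The set of values related to `x` is the intersection of the filter of all `V` with `x ∈ h V`. If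
it lies in the open set `U`, compactness puts some such `V` inside `U`. -/
theorem ImpHom.mem_toFun_iff {U : ClopenUpperSet Y} {x : X} :
    x ∈ h.toFun U ↔ ∀ y, h.rel x y → y ∈ U := by
  refine ⟨fun hU y hy => hy U hU, fun hx => ?_⟩
  -- The top element is written `U ⇨ U` because `h` is only given to preserve `⊓` and `⇨`.
  have : Nonempty {V // x ∈ h.toFun V} := ⟨U ⇨ U, by rw [h.map_himp, himp_self]; trivial⟩
  obtain ⟨V, hV⟩ := U.isClopen.compl.isClosed.isCompact.elim_directed_cover
    (fun V : {V // x ∈ h.toFun V} => ((V : ClopenUpperSet Y) : Set Y)ᶜ)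
    (fun V => V.1.isClopen.compl.isOpen)
    (fun y hy => by
      by_contra hn
      refine hy (hx y fun V hV => ?_)
      by_contra hyV
      exact hn (Set.mem_iUnion.2 ⟨⟨V, hV⟩, hyV⟩))
    (fun V W => ⟨⟨V.1 ⊓ W.1, by rw [h.map_inf]; exact ⟨V.2, W.2⟩⟩,
      Set.compl_subset_compl.2 Set.inter_subset_left,
      Set.compl_subset_compl.2 Set.inter_subset_right⟩)
  exact h.monotone (show V.1 ≤ U from Set.compl_subset_compl.1 hV) V.2

/-- Every value of the relation of `h` at `x` is the least value at some point above `x`. -/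
theorem ImpHom.exists_mem_funOf {x : X} {y : Y} (hxy : h.rel x y) :
    ∃ z, x ≤ z ∧ y ∈ funOf h.rel z := by
  have hclosed : IsClosed {z | h.rel z y} := by
    have : {z | h.rel z y} = ⋂ V : {V : ClopenUpperSet Y // y ∉ V}, (h.toFun V : Set X)ᶜ := by
      ext z
      rw [Set.mem_iInter, Subtype.forall]
      exact forall_congr' fun V => not_imp_not.symm
    rw [this]
    exact isClosed_iInter fun V => (h.toFun V).isClopen.compl.isClosed
  -- Maximality of `z` serves twice: for leastness of `y`, and for the maximality required by the
  -- domain of `funOf`.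
  obtain ⟨z, hxz, hz, hmax⟩ := exists_le_maximal_of_isClosed hclosed hxy
  refine ⟨z, hxz, mem_funOf.2 ⟨⟨hz, fun y' hy' => ?_⟩, rfl, fun z' hz' hle => ?_⟩⟩
  · by_contra hle
    obtain ⟨U, hyU, hyU'⟩ := ClopenUpperSet.exists_mem_notMem hle
    -- A point of the left side outside the union would be related to `y`, hence below `z` by
    -- maximality; then `z ∈ h U`, forcing `y' ∈ U`.
    have hcover : Set.Ici z ∩ (h.toFun U : Set X) ⊆
        ⋃ V : {V : ClopenUpperSet Y // y ∉ V}, (h.toFun V : Set X) := by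
      rintro z' ⟨hzz', hz'U⟩
      by_contra hn
      have hz' : h.rel z' y := fun V hV => by
        by_contra hyV
        exact hn (Set.mem_iUnion.2 ⟨⟨V, hyV⟩, hV⟩)
      exact hyU' (hy' U ((h.toFun U).upper (hmax hz' hzz') hz'U))
    have : Nonempty {V : ClopenUpperSet Y // y ∉ V} := ⟨⊥, ClopenUpperSet.notMem_bot⟩
    obtain ⟨V, hV⟩ := ((isClosed_Ici_of_priestley z).inter
      (h.toFun U).isClopen.isClosed).isCompact.elim_directed_cover
      (fun V : {V : ClopenUpperSet Y // y ∉ V} => (h.toFun V : Set X))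
      (fun V => (h.toFun V).isClopen.isOpen) hcover
      (fun V W => ⟨⟨V.1 ⊔ W.1, fun hy => hy.elim V.2 W.2⟩,
        h.monotone le_sup_left, h.monotone le_sup_right⟩)
    -- Since `z` is related to `y`, this puts `y` in `U ⇨ V`; but `y ∈ U` and `y ∉ V`.
    have hzUV : z ∈ h.toFun (U ⇨ V) := by
      rw [h.map_himp, ClopenUpperSet.mem_himp]
      exact fun z' hzz' hz'U => hV ⟨hzz', hz'U⟩
    exact V.2 (ClopenUpperSet.mem_himp.1 (hz _ hzUV) y le_rfl hyU)
  · exact hmax (show y ∈ {y | h.rel z' y} by rw [hz']; exact hz) hle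

theorem ImpHom.relOf_funOf_rel : relOf (funOf h.rel) = h.rel := by
  funext x y
  rw [eq_iff_iff]
  refine ⟨?_, fun hxy => h.exists_mem_funOf hxy⟩
  rintro ⟨z, hxz, hz⟩
  exact h.rel_of_le hxz (mem_funOf.1 hz).1.1 le_rfl

theorem ImpHom.isPartialEsakia_funOf_rel : IsPartialEsakia (funOf h.rel) where
  lt_of_lt x x' y y' hy hy' hlt := by
    rw [mem_funOf] at hy hy'
    have hyy' : y ≤ y' := hy.1.2 (h.rel_of_le hlt.le hy'.1.1 le_rfl)
    refine lt_of_le_of_ne hyy' ?_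
    rintro rfl
    -- Equal least values would make `x` and `x'` have the same related set, against the maximality
    -- of `x`.
    refine hlt.not_ge (hy.2.2 ?_ hlt.le)
    refine Set.Subset.antisymm (fun w hw => h.rel_of_le hlt.le hw le_rfl) fun w hw => ?_
    exact h.rel_of_le le_rfl hy'.1.1 (hy.1.2 hw)
  exists_of_lt x y y' hy hlt := by
    obtain ⟨z, hxz, hz⟩ :=
      h.exists_mem_funOf (h.rel_of_le le_rfl (mem_funOf.1 hy).1.1 hlt.le)
    refine ⟨z, lt_of_le_of_ne hxz ?_, hz⟩
    rintro rfl
    exact hlt.ne (Part.mem_unique hy hz)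
  isCU U hU := by
    rw [← box_relOf, h.relOf_funOf_rel]
    have : box h.rel U = h.toFun hU.toClopenUpperSet := by
      ext x
      exact (h.mem_toFun_iff (U := hU.toClopenUpperSet)).symm
    rw [this]
    exact isCU_coe _
  separated x y hy := by
    rw [image_Ici_eq, h.relOf_funOf_rel] at *
    obtain ⟨U, hU⟩ := not_forall.1 (show ¬ ∀ U, x ∈ h.toFun U → y ∈ U from hy)
    rw [Classical.not_imp] at hU
    exact ⟨U, isCU_coe U, fun y' hy' => hy' U hU.1, hU.2⟩

theorem ImpHom.dual_funOf_rel : h.isPartialEsakia_funOf_rel.dual = h := by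
  apply ImpHom.ext
  funext U
  refine SetLike.ext fun x => ?_
  rw [IsPartialEsakia.mem_dual, h.relOf_funOf_rel, h.mem_toFun_iff]

end Dual

end PartialEsakia

/-! ### The prime spectrum as an Esakia space -/

namespace PartialEsakia

/-- The space of prime filters of a Heyting algebra, given by their characteristic functions,
with the topology and the order of the power of a two-point space. -/
abbrev HeytingSpectrum (L : Type*) [HeytingAlgebra L] : Type _ :=
  {p : L → Bool // p ⊤ = true ∧ p ⊥ = false ∧ (∀ a b, p (a ⊓ b) = (p a && p b)) ∧
    ∀ a b, p (a ⊔ b) = (p a || p b)}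

namespace HeytingSpectrum

variable {L : Type*} [HeytingAlgebra L]

theorem apply_top (p : HeytingSpectrum L) : p.1 ⊤ = true := p.2.1

theorem not_apply_bot (p : HeytingSpectrum L) : ¬ p.1 ⊥ = true := by simp [p.2.2.1]

theorem apply_inf (p : HeytingSpectrum L) {a b : L} :
    p.1 (a ⊓ b) = true ↔ p.1 a = true ∧ p.1 b = true := by simp [p.2.2.2.1]

theorem apply_sup (p : HeytingSpectrum L) {a b : L} :
    p.1 (a ⊔ b) = true ↔ p.1 a = true ∨ p.1 b = true := by simp [p.2.2.2.2]

theorem le_iff {p q : HeytingSpectrum L} : p ≤ q ↔ ∀ a, p.1 a = true → q.1 a = true :=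
  Iff.rfl

theorem apply_mono (p : HeytingSpectrum L) {a b : L} (h : a ≤ b) (ha : p.1 a = true) :
    p.1 b = true := by
  rw [← inf_eq_left.2 h] at ha
  exact (p.apply_inf.1 ha).2

/-- The defining equations each involve finitely many coordinates, so they cut out a closed subset
of the compact cube `L → Bool`. -/
instance : CompactSpace (HeytingSpectrum L) := by
  refine isCompact_iff_compactSpace.1 (IsClosed.isCompact ?_)
  have hc (a : L) : Continuous fun p : L → Bool => p a := continuous_apply a
  have h2 {φ : Bool → Bool → Bool} (a b : L) : Continuous fun p : L → Bool => φ (p a) (p b) :=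
    (continuous_of_discreteTopology (f := fun x : Bool × Bool => φ x.1 x.2)).comp
      ((hc a).prodMk (hc b))
  have h3 {φ : Bool → Bool → Bool} (ψ : L → L → L) :
      IsClosed {p : L → Bool | ∀ a b, p (ψ a b) = φ (p a) (p b)} := by
    simp only [Set.ofPred_forall]
    exact isClosed_iInter fun a => isClosed_iInter fun b => isClosed_eq (hc _) (h2 a b)
  exact (isClosed_eq (hc ⊤) continuous_const).inter <|
    (isClosed_eq (hc ⊥) continuous_const).inter <| (h3 _).inter (h3 _)

/-- The set of the prime filters that contain `a`. -/
def basic (a : L) : Set (HeytingSpectrum L) := {p | p.1 a = true}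

theorem isClopen_basic (a : L) : IsClopen (basic a) :=
  (isClopen_discrete {true}).preimage ((continuous_apply a).comp continuous_subtype_val)

theorem isUpperSet_basic (a : L) : IsUpperSet (basic a) := fun _ _ h hp => h a hp

instance : PriestleySpace (HeytingSpectrum L) where
  priestley {p q} h := by
    rw [le_iff] at h
    push Not at h
    obtain ⟨a, ha, hb⟩ := h
    exact ⟨basic a, isClopen_basic a, isUpperSet_basic a, ha, hb⟩

/-- A filter is contained in a prime filter that omits a given element outside of it. -/
theorem exists_of_pfilter (F : Order.PFilter L) {b : L} (hb : b ∉ F) :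
    ∃ p : HeytingSpectrum L, (∀ a ∈ F, p.1 a = true) ∧ ¬ p.1 b = true := by
  classical
  obtain ⟨J, hJ, hbJ, hFJ⟩ := DistribLattice.prime_ideal_of_disjoint_filter_ideal
    (F := F) (I := Order.Ideal.principal b) (by
      rw [Set.disjoint_left]
      exact fun a ha hab => hb (F.mem_of_le hab ha))
  have htop : (⊤ : L) ∉ J := hJ.toIsProper.top_notMem
  -- The prime filter is the complement of the prime ideal `J`.
  refine ⟨⟨fun a => decide (a ∉ J), by simp [htop], by simp, fun a b => ?_, fun a b => ?_⟩, ?_, ?_⟩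
  · have : a ⊓ b ∈ J ↔ a ∈ J ∨ b ∈ J :=
      ⟨hJ.mem_or_mem, fun h => h.elim (J.lower inf_le_left) (J.lower inf_le_right)⟩
    simp [this]
  · simp [Order.Ideal.sup_mem_iff, imp_iff_not_or]
  · intro a ha
    simpa using Set.disjoint_left.1 hFJ ha
  · simpa using hbJ (Order.Ideal.mem_principal_self)

theorem exists_apply_of_not_le {a b : L} (h : ¬ a ≤ b) :
    ∃ p : HeytingSpectrum L, p.1 a = true ∧ ¬ p.1 b = true := by
  obtain ⟨p, hp, hb⟩ := exists_of_pfilter (Order.PFilter.principal a) (b := b) (by simpa using h)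
  exact ⟨p, hp a (by simp), hb⟩

/-- If `a ⇨ b` is not in `p`, then `{c | a ⇨ c ∈ p}` is a filter containing `p` and `a` but not `b`;
a prime filter extending it and omitting `b` refutes the right-hand side. -/
theorem apply_himp (p : HeytingSpectrum L) {a b : L} :
    p.1 (a ⇨ b) = true ↔ ∀ q, p ≤ q → q.1 a = true → q.1 b = true := by
  constructor
  · intro h q hpq ha
    exact q.apply_mono (b := b) inf_himp_le (q.apply_inf.2 ⟨ha, hpq _ h⟩)
  · intro h
    by_contra hp
    have hF : Order.IsPFilter {c | p.1 (a ⇨ c) = true} := by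
      refine Order.IsPFilter.of_def ⟨⊤, by simpa using p.apply_top⟩ ?_ ?_
      · intro c hc d hd
        refine ⟨c ⊓ d, ?_, inf_le_left, inf_le_right⟩
        change p.1 _ = true
        rw [himp_inf_distrib]
        exact p.apply_inf.2 ⟨hc, hd⟩
      · exact fun hcd hc => p.apply_mono (himp_le_himp_left hcd) hc
    obtain ⟨q, hq, hb⟩ := exists_of_pfilter hF.toPFilter (b := b) hp
    refine hb (h q (fun c hc => hq c (p.apply_mono le_himp hc)) (hq a ?_))
    change p.1 (a ⇨ a) = true
    rw [himp_self]
    exact p.apply_top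

/-- Differences of basic clopen upsets form a basis. -/
theorem exists_basic_diff_subset {U : Set (HeytingSpectrum L)} (hU : IsOpen U)
    {p : HeytingSpectrum L} (hp : p ∈ U) :
    ∃ a b, p ∈ basic a \ basic b ∧ basic a \ basic b ⊆ U := by
  have : Nonempty {ab : L × L // p ∈ basic ab.1 \ basic ab.2} :=
    ⟨⟨(⊤, ⊥), p.apply_top, p.not_apply_bot⟩⟩
  obtain ⟨i, hi⟩ := hU.isClosed_compl.isCompact.elim_directed_cover
    (fun i : {ab : L × L // p ∈ basic ab.1 \ basic ab.2} => (basic i.1.1 \ basic i.1.2)ᶜ)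
    (fun i => ((isClopen_basic _).diff (isClopen_basic _)).compl.isOpen)
    (fun q hq => by
      -- Distinct prime filters differ in one direction or the other, which gives a pair `(a, ⊥)` or
      -- `(⊤, a)`.
      have hne : ¬ (p ≤ q ∧ q ≤ p) := fun h => hq (le_antisymm h.1 h.2 ▸ hp)
      rw [not_and_or, le_iff, le_iff] at hne
      push Not at hne
      rw [Set.mem_iUnion]
      rcases hne with ⟨a, ha, ha'⟩ | ⟨a, ha, ha'⟩
      · exact ⟨⟨(a, ⊥), ha, p.not_apply_bot⟩, fun h => ha' h.1⟩
      · exact ⟨⟨(⊤, a), p.apply_top, ha'⟩, fun h => h.2 ha⟩)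
    (fun i j => ⟨⟨(i.1.1 ⊓ j.1.1, i.1.2 ⊔ j.1.2), p.apply_inf.2 ⟨i.2.1, j.2.1⟩,
      fun h => (p.apply_sup.1 h).elim i.2.2 j.2.2⟩,
      Set.compl_subset_compl.2 fun q hq => ⟨(q.apply_inf.1 hq.1).1,
        fun h => hq.2 (q.apply_sup.2 (Or.inl h))⟩,
      Set.compl_subset_compl.2 fun q hq => ⟨(q.apply_inf.1 hq.1).2,
        fun h => hq.2 (q.apply_sup.2 (Or.inr h))⟩⟩)
  exact ⟨i.1.1, i.1.2, i.2, Set.compl_subset_compl.1 hi⟩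

theorem lowerClosure_basic_diff (a b : L) :
    (lowerClosure (basic a \ basic b) : Set (HeytingSpectrum L)) = (basic (a ⇨ b))ᶜ := by
  ext p
  rw [SetLike.mem_coe, mem_lowerClosure, Set.mem_compl_iff]
  change _ ↔ ¬ p.1 (a ⇨ b) = true
  rw [apply_himp]
  push Not
  exact ⟨fun ⟨q, hq, h⟩ => ⟨q, h, hq⟩, fun ⟨q, h, hq⟩ => ⟨q, hq, h⟩⟩

/-- By compactness a clopen set is a finite union of differences of basic sets; downsets commute
with unions, and `lowerClosure_basic_diff` handles each piece. -/
instance : EsakiaSpace (HeytingSpectrum L) where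
  isClopen_lowerClosure U hU := by
    choose! a b hp hU' using fun p (hp : p ∈ U) => exists_basic_diff_subset hU.isOpen hp
    obtain ⟨t, htU, ht⟩ := hU.isClosed.isCompact.elim_nhds_subcover
      (fun p => basic (a p) \ basic (b p))
      (fun p h => ((isClopen_basic _).diff (isClopen_basic _)).isOpen.mem_nhds (hp p h))
    have : (lowerClosure U : Set (HeytingSpectrum L)) = ⋃ p ∈ t, (basic (a p ⇨ b p))ᶜ := by
      have hUt : U = ⋃ p ∈ t, basic (a p) \ basic (b p) :=
        ht.antisymm (Set.iUnion₂_subset fun p h => hU' p (htU p h))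
      conv_lhs => rw [hUt]
      simp only [lowerClosure_iUnion, LowerSet.coe_iSup, lowerClosure_basic_diff]
    rw [this]
    exact t.finite_toSet.isClopen_biUnion fun p _ => (isClopen_basic _).compl

/-- The clopen upset of the prime filters that contain `a`. -/
def basicCU (a : L) : ClopenUpperSet (HeytingSpectrum L) :=
  ⟨⟨basic a, isClopen_basic a⟩, isUpperSet_basic a⟩

theorem basicCU_injective : Function.Injective (basicCU (L := L)) := fun a b hab => by
  have key : ∀ {a b : L}, basicCU a = basicCU b → a ≤ b := fun {a b} hab => by
    by_contra hn
    obtain ⟨p, ha, hb⟩ := exists_apply_of_not_le hn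
    have : p ∈ basicCU a := ha
    rw [hab] at this
    exact hb this
  exact le_antisymm (key hab) (key hab.symm)

/-- Compactness is used twice: on the complement of `U`, with meets, to fit a basic set around each
point inside `U`; then on `U`, with joins, to merge these into one. -/
theorem basicCU_surjective : Function.Surjective (basicCU (L := L)) := fun U => by
  have hpt : ∀ p ∈ U, ∃ a, p ∈ basic a ∧ basic a ⊆ (U : Set (HeytingSpectrum L)) := by
    intro p hp
    have : Nonempty {a // p ∈ basic a} := ⟨⊤, p.apply_top⟩
    obtain ⟨a, ha⟩ := U.isClopen.compl.isClosed.isCompact.elim_directed_cover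
      (fun a : {a // p ∈ basic a} => (basic (a : L))ᶜ)
      (fun a => (isClopen_basic _).compl.isOpen)
      (fun q hq => by
        have hpq : ¬ p ≤ q := fun h => hq (U.upper h hp)
        rw [le_iff] at hpq
        push Not at hpq
        obtain ⟨a, ha, ha'⟩ := hpq
        exact Set.mem_iUnion.2 ⟨⟨a, ha⟩, ha'⟩)
      (fun a b => ⟨⟨a ⊓ b, p.apply_inf.2 ⟨a.2, b.2⟩⟩,
        Set.compl_subset_compl.2 fun q hq => (q.apply_inf.1 hq).1,
        Set.compl_subset_compl.2 fun q hq => (q.apply_inf.1 hq).2⟩)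
    exact ⟨a, a.2, Set.compl_subset_compl.1 ha⟩
  have : Nonempty {a : L // basic a ⊆ (U : Set (HeytingSpectrum L))} :=
    ⟨⊥, fun p hp => (p.not_apply_bot hp).elim⟩
  obtain ⟨a, ha⟩ := U.isClopen.isClosed.isCompact.elim_directed_cover
    (fun a : {a : L // basic a ⊆ (U : Set (HeytingSpectrum L))} => basic (a : L))
    (fun a => (isClopen_basic _).isOpen)
    (fun p hp => by
      obtain ⟨a, ha, haU⟩ := hpt p hp
      exact Set.mem_iUnion.2 ⟨⟨a, haU⟩, ha⟩)
    (fun a b => ⟨⟨a ⊔ b, fun p hp => (p.apply_sup.1 hp).elim (fun h => a.2 h) fun h => b.2 h⟩,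
      fun p hp => p.apply_sup.2 (Or.inl hp), fun p hp => p.apply_sup.2 (Or.inr hp)⟩)
  exact ⟨a, SetLike.coe_injective (Set.Subset.antisymm a.2 ha)⟩

theorem basicCU_inf (a b : L) : basicCU (a ⊓ b) = basicCU a ⊓ basicCU b :=
  SetLike.ext fun p => p.apply_inf

/-- Every Heyting algebra is isomorphic to the algebra of clopen upsets of its prime spectrum. -/
noncomputable def orderIso (L : Type*) [HeytingAlgebra L] :
    L ≃o ClopenUpperSet (HeytingSpectrum L) where
  toEquiv := Equiv.ofBijective basicCU ⟨basicCU_injective, basicCU_surjective⟩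
  map_rel_iff' {a b} := by
    change basicCU a ≤ basicCU b ↔ a ≤ b
    rw [← inf_eq_left, ← basicCU_inf, basicCU_injective.eq_iff, inf_eq_left]

end HeytingSpectrum

end PartialEsakia

/-! ### The functors and the three equivalences -/

namespace PartialEsakia

/-- The functor that sends an Esakia space to the Heyting algebra of its clopen upsets. -/
noncomputable def clopenUpsets : EsakiaP.{u}ᵒᵖ ⥤ HeytAlgImp.{u} where
  obj X := ⟨ClopenUpperSet X.unop.carrier⟩
  map f := f.unop.isPartialEsakia.dual
  map_id X := by
    apply ImpHom.ext
    funext U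
    refine SetLike.ext fun x => ?_
    constructor
    · exact fun h => h x ⟨x, le_rfl, Part.mem_some x⟩
    · rintro h y ⟨z, hz, hy⟩
      rw [Part.mem_some_iff.1 hy]
      exact U.upper hz h
  map_comp {X Y Z} f g := by
    apply ImpHom.ext
    funext U
    refine SetLike.ext fun x => ?_
    have hf := f.unop.isPartialEsakia
    have hg := g.unop.isPartialEsakia
    change x ∈ box (relOf (pcomp f.unop.toPFun g.unop.toPFun)) U ↔
      x ∈ box (relOf g.unop.toPFun) (box (relOf f.unop.toPFun) U)
    rw [hf.pcomp_eq hg, hg.box_comp]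

theorem clopenUpsets_map {X Y : EsakiaP.{u}ᵒᵖ} (f : X ⟶ Y) :
    clopenUpsets.map f = f.unop.isPartialEsakia.dual := rfl

instance : clopenUpsets.{u}.Faithful where
  map_injective {_ _ f g} h := Quiver.Hom.unop_inj <| PartialEsakiaHom.ext <|
    f.unop.isPartialEsakia.eq_of_dual_eq g.unop.isPartialEsakia h

/-- The partial Esakia function dual to a `(∧, →)`-homomorphism, as a morphism. -/
noncomputable def ImpHom.toHom {X Y : EsakiaP.{u}}
    (h : ImpHom (ClopenUpperSet Y.carrier) (ClopenUpperSet X.carrier)) : X ⟶ Y :=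
  PartialEsakiaHom.mk (funOf h.rel) h.isPartialEsakia_funOf_rel

instance : clopenUpsets.{u}.Full where
  map_surjective h := ⟨(ImpHom.toHom h).op, ImpHom.dual_funOf_rel h⟩

/-- An order isomorphism of Heyting algebras preserves implication. -/
def ImpHom.ofOrderIso {L K : Type u} [HeytingAlgebra L] [HeytingAlgebra K] (e : L ≃o K) :
    ImpHom L K := ⟨e, InfHomClass.map_inf e, HeytingHomClass.map_himp e⟩

/-- The isomorphism of `HeytAlgImp` given by an order isomorphism. -/
def HeytAlgImp.isoMk {L K : HeytAlgImp.{u}} (e : L.carrier ≃o K.carrier) : L ≅ K where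
  hom := ImpHom.ofOrderIso e
  inv := ImpHom.ofOrderIso e.symm
  hom_inv_id := ImpHom.ext (funext fun a => e.symm_apply_apply a)
  inv_hom_id := ImpHom.ext (funext fun a => e.apply_symm_apply a)

instance : clopenUpsets.{u}.EssSurj where
  mem_essImage L := ⟨.op ⟨HeytingSpectrum L.carrier⟩,
    ⟨HeytAlgImp.isoMk (HeytingSpectrum.orderIso L.carrier).symm⟩⟩

instance : clopenUpsets.{u}.IsEquivalence where

/-- The functor `clopenUpsets` restricted to well partial Esakia functions. -/
noncomputable def clopenUpsetsBot : EsakiaW.{u}ᵒᵖ ⥤ HeytAlgImpBot.{u} where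
  obj X := ⟨clopenUpsets.obj (.op X.unop.obj)⟩
  map f := ⟨clopenUpsets.map f.unop.hom.op,
    f.unop.hom.isPartialEsakia.isWell_iff.1 f.unop.property⟩
  map_id X := WideSubcategory.hom_ext _ (clopenUpsets.map_id (.op X.unop.obj))
  map_comp f g := WideSubcategory.hom_ext _ (clopenUpsets.map_comp f.unop.hom.op g.unop.hom.op)

instance : clopenUpsetsBot.{u}.Faithful where
  map_injective h := Quiver.Hom.unop_inj <| WideSubcategory.hom_ext _ <|
    Quiver.Hom.op_inj <| clopenUpsets.map_injective <| congrArg InducedWideCategory.Hom.hom h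

instance : clopenUpsetsBot.{u}.Full where
  map_surjective {X Y} h := by
    obtain ⟨f, hf⟩ := clopenUpsets.map_surjective
      (X := Opposite.op X.unop.obj) (Y := Opposite.op Y.unop.obj) h.hom
    have hw : isWell f.unop := f.unop.isPartialEsakia.isWell_iff.2 (by
      rw [← clopenUpsets_map, hf]
      exact h.property)
    exact ⟨Quiver.Hom.op (⟨f.unop, hw⟩ : Y.unop ⟶ X.unop), WideSubcategory.hom_ext _ hf⟩

instance : clopenUpsetsBot.{u}.EssSurj where
  mem_essImage L := ⟨.op ⟨⟨HeytingSpectrum L.obj.carrier⟩⟩,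
    -- Both directions of the isomorphism must lie in the wide subcategory; order isomorphisms
    -- preserve `⊥`.
    ⟨WideSubcategory.isoMk (HeytAlgImp.isoMk (HeytingSpectrum.orderIso L.obj.carrier).symm)
      (show (HeytingSpectrum.orderIso L.obj.carrier).symm ⊥ = ⊥ from map_bot _)
      (show HeytingSpectrum.orderIso L.obj.carrier ⊥ = ⊥ from map_bot _)⟩⟩

instance : clopenUpsetsBot.{u}.IsEquivalence where

/-- The functor `clopenUpsets` restricted to partial Heyting functions. -/
noncomputable def clopenUpsetsHeyting : EsakiaH.{u}ᵒᵖ ⥤ HeytAlg.{u} where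
  obj X := .of (ClopenUpperSet X.unop.obj.carrier)
  map f := HeytAlg.ofHom
    { toFun := f.unop.hom.isPartialEsakia.dual.toFun
      map_sup' := (f.unop.hom.isPartialEsakia.isHeyting_iff_dual.1 f.unop.property).2
      map_inf' := f.unop.hom.isPartialEsakia.dual.map_inf
      map_bot' := (f.unop.hom.isPartialEsakia.isHeyting_iff_dual.1 f.unop.property).1
      map_himp' := f.unop.hom.isPartialEsakia.dual.map_himp }
  map_id X := HeytAlg.ext fun U =>
    congrFun (congrArg ImpHom.toFun (clopenUpsets.map_id (.op X.unop.obj))) U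
  map_comp f g := HeytAlg.ext fun U =>
    congrFun (congrArg ImpHom.toFun (clopenUpsets.map_comp f.unop.hom.op g.unop.hom.op)) U

instance : clopenUpsetsHeyting.{u}.Faithful where
  map_injective {_ _ f g} h := Quiver.Hom.unop_inj <| WideSubcategory.hom_ext _ <|
    PartialEsakiaHom.ext <|
    f.unop.hom.isPartialEsakia.eq_of_dual_eq g.unop.hom.isPartialEsakia <|
    ImpHom.ext <| funext fun U => congrArg (fun k => k.hom U) h

instance : clopenUpsetsHeyting.{u}.Full where
  map_surjective {X Y} h := by
    let φ : HeytingHom (ClopenUpperSet X.unop.obj.carrier)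
      (ClopenUpperSet Y.unop.obj.carrier) := h.hom
    let k : ImpHom (ClopenUpperSet X.unop.obj.carrier) (ClopenUpperSet Y.unop.obj.carrier) :=
      ⟨φ, map_inf φ, map_himp φ⟩
    -- The dual of `funOf k.rel` is `k` itself, which preserves `⊥` and `⊔` because `φ` does.
    have hk : IsHeyting (funOf k.rel) := k.isPartialEsakia_funOf_rel.isHeyting_iff_dual.2 (by
      rw [k.dual_funOf_rel]
      exact ⟨map_bot φ, map_sup φ⟩)
    refine ⟨Quiver.Hom.op (⟨k.toHom, hk⟩ : Y.unop ⟶ X.unop), HeytAlg.ext fun U => ?_⟩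
    exact congrFun (congrArg ImpHom.toFun k.dual_funOf_rel) U

instance : clopenUpsetsHeyting.{u}.EssSurj where
  mem_essImage L := ⟨.op ⟨⟨HeytingSpectrum L⟩⟩,
    ⟨HeytAlg.Iso.mk (HeytingSpectrum.orderIso L).symm⟩⟩

instance : clopenUpsetsHeyting.{u}.IsEquivalence where

end PartialEsakia

theorem mainTheorem6 :
    Nonempty (PartialEsakia.HeytAlgImp.{u} ≌ PartialEsakia.EsakiaP.{u}ᵒᵖ) ∧
    Nonempty (PartialEsakia.HeytAlgImpBot.{u} ≌ PartialEsakia.EsakiaW.{u}ᵒᵖ) ∧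
    Nonempty (HeytAlg.{u} ≌ PartialEsakia.EsakiaH.{u}ᵒᵖ) :=
  ⟨⟨PartialEsakia.clopenUpsets.asEquivalence.symm⟩,
    ⟨PartialEsakia.clopenUpsetsBot.asEquivalence.symm⟩,
    ⟨PartialEsakia.clopenUpsetsHeyting.asEquivalence.symm⟩⟩
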